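/- Let $R$ be a commutative ring with identity and let $S\subseteq R$ be a multiplicative subset ($1\in S$ and $S$ is closed under products) all of whose elements are non-zero-divisors. For $s\in S$ and an $R$-module $M$ say that - $M$ is *$S$-finite with respect to $s$* if $sM\subseteq N$ for some finitely generated submodule $N\subseteq M$; - $M$ is *$u$-$S$-finitely presented with respect to $s$* if there is an exact sequence $0\to T_1\to F\to M\to T_2\to 0$ with $F$ finitely presented and $sT_1=sT_2=0$; - $M$ is *$u$-$S$-flat with respect to $s$* if, for every finitely generated ideal $I$ of $R$, $s$ annihilates the kernel of $I\otimes_R M\to M$ (that is, $s\,\mathrm{Tor}_1^R(R/I,M)=0$); - $M$ is *$u$-$S$-injective with respect to $s$* if $s\,\mathrm{Ext}^1_R(N,M)=0$ for every $R$-module $N$; equivalently, for every monomorphism $A\hookrightarrow B$ and every homomorphism $f:A\to M$, the map $sf$ extends to $B$; - $M$ is *$u$-$S$-absolutely pure with respect to $s$* if $s\,\mathrm{Ext}^1_R(N,M)=0$ for every finitely presented $R$-module $N$. The ring $R$ is *$u$-$S$-coherent* if there is $s\in S$ such that $R$ is $S$-finite with respect to $s$ and every finitely generated ideal of $R$ is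 $u$-$S$-finitely presented with respect to $s$. An *injective cogenerator* is an injective module $E$ such that for every module $M$ and every $0\ne x\in M$ there is a homomorphism $f:M\to E$ with $f(x)\neq 0$. Then the following statements are equivalent. 1. $R$ is a $u$-$S$-coherent ring. 2. There are $s_1,s_2\in S$ such that $\mathrm{Hom}_R(M,E)$ is $u$-$S$-flat with respect to $s_1$ for every module $M$ that is $u$-$S$-absolutely pure with respect to $s_2$ and every injective module $E$. 3. There are $s_1,s_2\in S$ such that $\mathrm{Hom}_R(M,E)$ is $u$-$S$-flat with respect to $s_1$ for every module $M$ that is $u$-$S$-injective with respect to $s_2$ and every injective module $E$. 4. There are $s_1,s_2\in S$ such that $\mathrm{Hom}_R(M,E)$ is $u$-$S$-flat with respect to $s_1$ for every module $M$ that is $u$-$S$-injective with respect to $s_2$ and every injective cogenerator $E$. 5. There are $s_1,s_2\in S$ such that $\mathrm{Hom}_R(\mathrm{Hom}_R(M,E_1),E_2)$ is $u$-$S$-flat with respect to $s_1$ for every module $M$ that is $u$-$S$-flat with respect to $s_2$ and all injective modules $E_1,E_2$. 6. There are $s_1,s_2\in S$ such that $\mathrm{Hom}_R(\mathrm{Hom}_R(M,E_1),E_2)$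 is $u$-$S$-flat with respect to $s_1$ for every module $M$ that is $u$-$S$-flat with respect to $s_2$ and all injective cogenerators $E_1,E_2$. 7. There is $s\in S$ such that $\mathrm{Hom}_R(E_1,E_2)$ is $u$-$S$-flat with respect to $s$ for all injective cogenerators $E_1,E_2$. -/

import Mathlib

open scoped TensorProduct

universe u

namespace UniformlyS

section Defs

variable {R : Type u} [CommRing R]

/-- `M` is `S`-finite with respect to `s`: some finitely generated submodule `N` of `M`
satisfies `s M ⊆ N ⊆ M`. -/
def SFinite (s : R) (M : Type u) [AddCommGroup M] [Module R M] : Prop :=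
  ∃ N : Submodule R M, N.FG ∧ ∀ m : M, s • m ∈ N

/-- `M` is `u`-`S`-finitely presented with respect to `s`: there is an exact sequence
`0 → T₁ → F → M → T₂ → 0` with `F` finitely presented and `s T₁ = s T₂ = 0`
(here `T₁` and `T₂` are the kernel and the cokernel of `f : F → M`). -/
def FinPres (s : R) (M : Type u) [AddCommGroup M] [Module R M] : Prop :=
  ∃ (F : Type u) (_ : AddCommGroup F) (_ : Module R F) (f : F →ₗ[R] M),
    Module.FinitePresentation R F ∧
      (∀ x ∈ LinearMap.ker f, s • x = 0) ∧
      (∀ y : M ⧸ LinearMap.range f, s • y = 0)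

/-- `M` is a `u`-`S`-coherent module: for one and the same `s ∈ S`, the module is `S`-finite
with respect to `s` and each of its finitely generated submodules is `u`-`S`-finitely presented
with respect to `s`. -/
def IsCoherentModule (S : Submonoid R) (M : Type u) [AddCommGroup M] [Module R M] : Prop :=
  ∃ s ∈ S, SFinite s M ∧ ∀ N : Submodule R M, N.FG → FinPres s N

/-- `R` is a `u`-`S`-coherent ring: it is a `u`-`S`-coherent module over itself. -/
def IsCoherentRing (S : Submonoid R) : Prop :=
  IsCoherentModule S R

/-- `F` is `u`-`S`-flat with respect to `s`: for every finitely generated ideal `I`, the element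
`s` kills the kernel of the multiplication map `I ⊗ F → F`. That kernel is `Tor₁ (R ⧸ I) F`;
the case `s = 1` is flatness. -/
def Flat (s : R) (F : Type u) [AddCommGroup F] [Module R F] : Prop :=
  ∀ I : Ideal R, I.FG →
    ∀ x : I ⊗[R] F,
      TensorProduct.lift ((LinearMap.lsmul R F).comp I.subtype) x = 0 → s • x = 0

/-- `M` is `u`-`S`-injective with respect to `s`: for every monomorphism `i : A → B`, the element
`s` kills the cokernel of `Hom (B, M) → Hom (A, M)`; equivalently `s` kills `Ext¹ (N, M)` for
every module `N`. -/
def Inj (s : R) (M : Type u) [AddCommGroup M] [Module R M] : Prop :=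
  ∀ (A B : Type u) [AddCommGroup A] [AddCommGroup B] [Module R A] [Module R B]
    (i : A →ₗ[R] B), Function.Injective i →
      ∀ f : A →ₗ[R] M, ∃ g : B →ₗ[R] M, g ∘ₗ i = s • f

/-- `M` is `u`-`S`-absolutely pure with respect to `s`: `s` kills `Ext¹ (N, M)` for every finitely
presented module `N = Rⁿ ⧸ K`, where `Ext¹ (N, M)` is the cokernel of
`Hom (Rⁿ, M) → Hom (K, M)`. -/
def AbsPure (s : R) (M : Type u) [AddCommGroup M] [Module R M] : Prop :=
  ∀ (n : ℕ) (K : Submodule R (Fin n → R)), K.FG →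
    ∀ f : K →ₗ[R] M, ∃ g : (Fin n → R) →ₗ[R] M, g ∘ₗ K.subtype = s • f

variable (R) in
/-- `E` is an injective cogenerator: an injective module such that the homomorphisms into `E`
separate the elements of every module. -/
def IsInjCogenerator (E : Type u) [AddCommGroup E] [Module R E] : Prop :=
  Module.Injective R E ∧
    ∀ (M : Type u) [AddCommGroup M] [Module R M] (x : M), x ≠ 0 → ∃ f : M →ₗ[R] E, f x ≠ 0

end Defs

end UniformlyS

/-! Forward: if `I` is finitely presented up to `s`, then `I ⊗ Hom (M, E)` embeds in `Hom (Hom (I,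
M), E)` up to `s ^ 3`. If maps `I → M` also extend to `R` up to `t`, then `s ^ 3 * t` kills the
kernel of `I ⊗ Hom (M, E) → Hom (M, E)`. Such extensions exist for absolutely pure `M` and for duals
of flat modules.

Converse (`finPres_of_flat`): let `K` be the relation module of generators `a` of `I`, and `E` an
injective cogenerator. All of `K` is encoded in one relation of `a` over `Hom (E ^ K, E)`. Flatness
resolves it by finitely many relations in `R`, and the cogenerator shows that their span contains `s
K`. -/

namespace UniformlyS

section Lemmas

variable {R : Type u} [CommRing R]

/-- A homomorphism into an injective module factors through any homomorphism with a smaller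
kernel. -/
theorem exists_comp_eq_of_ker_le {A B E : Type u} [AddCommGroup A] [Module R A]
    [AddCommGroup B] [Module R B] [AddCommGroup E] [Module R E] (hE : Module.Injective R E)
    (f : A →ₗ[R] B) (g : A →ₗ[R] E) (h : LinearMap.ker f ≤ LinearMap.ker g) :
    ∃ k : B →ₗ[R] E, ∀ a, k (f a) = g a := by
  obtain ⟨k, hk⟩ := hE.out ((LinearMap.ker f).liftQ f le_rfl)
    (LinearMap.ker_eq_bot.mp (Submodule.ker_liftQ_eq_bot _ _ _ le_rfl))
    ((LinearMap.ker f).liftQ g h)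
  exact ⟨k, fun a ↦ by simpa using hk (Submodule.Quotient.mk a)⟩

/-- If `f` has cokernel killed by `s` and `g` vanishes on its kernel, then `s • g` factors
through `f`. -/
theorem exists_comp_eq_smul_of_ker_le {A B M : Type u} [AddCommGroup A] [Module R A]
    [AddCommGroup B] [Module R B] [AddCommGroup M] [Module R M] {s : R} (f : A →ₗ[R] B)
    (hf : ∀ b, s • b ∈ LinearMap.range f) (g : A →ₗ[R] M)
    (h : LinearMap.ker f ≤ LinearMap.ker g) :
    ∃ k : B →ₗ[R] M, ∀ a, k (f a) = s • g a := by
  refine ⟨(LinearMap.ker f).liftQ g h ∘ₗ f.quotKerEquivRange.symm.toLinearMap ∘ₗ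
    (LinearMap.lsmul R B s).codRestrict _ hf, fun a ↦ ?_⟩
  have : (LinearMap.lsmul R B s).codRestrict _ hf (f a) =
      f.quotKerEquivRange (Submodule.Quotient.mk (s • a)) :=
    Subtype.ext (by
      rw [LinearMap.quotKerEquivRange_apply_mk, map_smul]
      rfl)
  simp [this]

/-! ### Evaluation and tensor products -/

/-- The evaluation homomorphism `N ⊗ Hom (M, E) → Hom (Hom (N, M), E)`. -/
noncomputable def evalTensor (N M E : Type u) [AddCommGroup N] [Module R N] [AddCommGroup M]
    [Module R M] [AddCommGroup E] [Module R E] :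
    N ⊗[R] (M →ₗ[R] E) →ₗ[R] (N →ₗ[R] M) →ₗ[R] E :=
  TensorProduct.lift ((LinearMap.llcomp R (N →ₗ[R] M) M E).flip ∘ₗ LinearMap.applyₗ)

section evalTensor

variable {N M E : Type u} [AddCommGroup N] [Module R N] [AddCommGroup M]
    [Module R M] [AddCommGroup E] [Module R E]

@[simp]
theorem evalTensor_tmul (n : N) (h : M →ₗ[R] E) (g : N →ₗ[R] M) :
    evalTensor N M E (n ⊗ₜ h) g = h (g n) := rfl

theorem evalTensor_map {N' : Type u} [AddCommGroup N'] [Module R N'] (f : N →ₗ[R] N')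
    (x : N ⊗[R] (M →ₗ[R] E)) (g : N' →ₗ[R] M) :
    evalTensor N' M E (f.rTensor _ x) g = evalTensor N M E x (g ∘ₗ f) := by
  induction x with
  | zero => simp
  | tmul n h => simp
  | add x y hx hy => simp [hx, hy]

theorem evalTensor_restrict (I : Ideal R) (x : I ⊗[R] (M →ₗ[R] E)) (m : M) :
    evalTensor I M E x ((LinearMap.toSpanSingleton R M m).comp I.subtype) =
      TensorProduct.lift ((LinearMap.lsmul R (M →ₗ[R] E)).comp I.subtype) x m := by
  induction x with
  | zero => simp
  | tmul n h => simp
  | add x y hx hy => simp [hx, hy]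

theorem exists_eq_sum_tmul {H : Type u} [AddCommGroup H] [Module R H] {n : ℕ}
    {p : (Fin n → R) →ₗ[R] N} (hp : Function.Surjective p) (x : N ⊗[R] H) :
    ∃ h : Fin n → H, x = ∑ i, p (Pi.single i 1) ⊗ₜ h i := by
  induction x with
  | zero => exact ⟨0, by simp⟩
  | tmul y g =>
    obtain ⟨r, rfl⟩ := hp y
    refine ⟨fun i ↦ r i • g, ?_⟩
    conv_lhs => rw [pi_eq_sum_univ' r, map_sum, TensorProduct.sum_tmul]
    refine Finset.sum_congr rfl fun i _ ↦ ?_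
    rw [map_smul, TensorProduct.smul_tmul]
  | add x y hx hy =>
    obtain ⟨h, rfl⟩ := hx
    obtain ⟨h', rfl⟩ := hy
    exact ⟨h + h', by simp [TensorProduct.tmul_add, Finset.sum_add_distrib]⟩

/-- `Hom (N, M)` is the kernel of the relation matrix `Φ : Mⁿ → Mᵐ`. A functional on `Mⁿ` vanishing
there factors through `Φ` because `E` is injective, and the components of the factor witness that
the tensor vanishes trivially. -/
theorem evalTensor_injective [Module.FinitePresentation R N] (hE : Module.Injective R E) :
    Function.Injective (evalTensor (R := R) N M E) := by
  rw [injective_iff_map_eq_zero]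
  intro x hx
  obtain ⟨n, m, p, q, hp, hpq⟩ := Module.FinitePresentation.exists_fin' R N
  obtain ⟨h, rfl⟩ := exists_eq_sum_tmul hp x
  let b : Fin m → Fin n → R := fun j ↦ q (Pi.single j 1)
  let Φ : (Fin n → M) →ₗ[R] (Fin m → M) :=
    LinearMap.pi fun j ↦ ∑ i, b j i • LinearMap.proj i
  have hΦ (v j) : Φ v j = ∑ i, b j i • v i := by simp [Φ]
  obtain ⟨k, hk⟩ := exists_comp_eq_of_ker_le hE Φ (∑ i, h i ∘ₗ LinearMap.proj i) (by
    intro v hv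
    have hL : LinearMap.ker p ≤ LinearMap.ker (Fintype.linearCombination R v) := by
      rw [hpq.linearMap_ker_eq]
      rintro _ ⟨c, rfl⟩
      have : Fintype.linearCombination R v ∘ₗ q = 0 := by
        refine LinearMap.pi_ext' fun j ↦ LinearMap.ext_ring ?_
        have := hΦ v j
        rw [LinearMap.mem_ker.mp hv] at this
        simpa [Fintype.linearCombination_apply, b] using this.symm
      exact LinearMap.congr_fun this c
    obtain ⟨G, hG⟩ := exists_comp_eq_smul_of_ker_le (s := 1) p
      (fun y ↦ by simpa using hp y) _ hL
    have := LinearMap.congr_fun hx G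
    simpa [hG] using this)
  refine TensorProduct.sum_tmul_eq_zero_of_vanishesTrivially R
    ⟨m, fun i j ↦ b j i, fun j ↦ k ∘ₗ LinearMap.single R (fun _ ↦ M) j, fun i ↦ ?_, fun j ↦ ?_⟩
  · ext y
    have h1 : (∑ i, h i ∘ₗ LinearMap.proj i) (Pi.single i y) = h i y := by
      simp [Pi.single_apply, apply_ite]
    have h2 : Φ (Pi.single i y) = ∑ j, b j i • Pi.single j y := by
      ext j
      simp [hΦ, Pi.single_apply, apply_ite]
    rw [← h1, ← hk, h2]
    simp
  · have : p (b j) = 0 := (hpq _).mpr ⟨_, rfl⟩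
    rw [← this]
    conv_rhs => rw [pi_eq_sum_univ' (b j), map_sum]
    refine Finset.sum_congr rfl fun i _ ↦ ?_
    rw [map_smul]

/-- `evalTensor` has bounded kernel on modules that are finitely presented up to `s`. -/
theorem FinPres.smul_eq_zero_of_evalTensor {s : R} (hN : FinPres s N) (hE : Module.Injective R E)
    {x : N ⊗[R] (M →ₗ[R] E)} (hx : evalTensor N M E x = 0) : s ^ 3 • x = 0 := by
  obtain ⟨F, _, _, f, _, hker, hcok⟩ := hN
  have hran (b : N) : s • b ∈ LinearMap.range f := by
    simpa [← Submodule.Quotient.mk_smul] using hcok (Submodule.Quotient.mk b)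
  obtain ⟨y, hy⟩ : s • x ∈ LinearMap.range (f.rTensor (M →ₗ[R] E)) := by
    clear hx
    induction x with
    | zero => simp
    | tmul n h =>
      obtain ⟨a, ha⟩ := hran n
      exact ⟨a ⊗ₜ h, by simp [ha, TensorProduct.smul_tmul']⟩
    | add x y hx hy => rw [smul_add]; exact add_mem hx hy
  -- One `s` makes `G` vanish on the kernel of `f`, a second pays for the cokernel; the third was
  -- spent on lifting `s • x` to `y`.
  have hy0 : s ^ 2 • y = 0 := by
    refine (injective_iff_map_eq_zero _).mp (evalTensor_injective hE) _ (LinearMap.ext fun G ↦ ?_)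
    obtain ⟨g, hg⟩ := exists_comp_eq_smul_of_ker_le f hran (s • G) (fun a ha ↦ by
      simp [← map_smul, hker a ha])
    have h1 : g ∘ₗ f = s ^ 2 • G := by
      ext a
      simp [hg, pow_two, mul_smul]
    have h2 := evalTensor_map f y g
    rw [hy, h1] at h2
    simpa [hx] using h2.symm
  rw [pow_succ, mul_smul, ← hy, ← map_smul, hy0, map_zero]

/-- If `I` is finitely presented up to `s` and homomorphisms `I → M` extend to `R` up to `t`, then
`s ^ 3 * t` kills the kernel of `I ⊗ Hom (M, E) → Hom (M, E)`. -/
theorem smul_eq_zero_of_lift_eq_zero {s t : R} {I : Ideal R} (hI : FinPres s I)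
    (hE : Module.Injective R E) (hM : ∀ g : I →ₗ[R] M, ∃ m : M, ∀ i : I, t • g i = (i : R) • m)
    {x : I ⊗[R] (M →ₗ[R] E)}
    (hx : TensorProduct.lift ((LinearMap.lsmul R (M →ₗ[R] E)).comp I.subtype) x = 0) :
    (s ^ 3 * t) • x = 0 := by
  rw [mul_smul]
  refine hI.smul_eq_zero_of_evalTensor hE (LinearMap.ext fun g ↦ ?_)
  obtain ⟨m, hm⟩ := hM g
  have h := evalTensor_restrict I x m
  have h1 : (LinearMap.toSpanSingleton R M m).comp I.subtype = t • g := by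
    ext i
    simp [hm]
  rw [hx, h1] at h
  simpa using h

end evalTensor

/-! ### Extension from ideals, and injective cogenerators -/

theorem AbsPure.exists_smul_eq {t : R} {M : Type u} [AddCommGroup M] [Module R M]
    (hM : AbsPure t M) {I : Ideal R} (hI : I.FG) (g : I →ₗ[R] M) :
    ∃ m : M, ∀ i : I, t • g i = (i : R) • m := by
  let e : R ≃ₗ[R] (Fin 1 → R) := (LinearEquiv.funUnique (Fin 1) R R).symm
  obtain ⟨k, hk⟩ := hM 1 (Submodule.map e.toLinearMap I) (Submodule.FG.map _ hI)
    (g ∘ₗ (e.submoduleMap I).symm.toLinearMap)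
  refine ⟨k (e 1), fun i ↦ ?_⟩
  have h := LinearMap.congr_fun hk (e.submoduleMap I i)
  have h1 : ((e.submoduleMap I i : _) : Fin 1 → R) = (i : R) • e 1 := by
    rw [← map_smul]
    simp [LinearEquiv.submoduleMap_apply]
  rw [LinearMap.comp_apply, Submodule.subtype_apply, h1, map_smul] at h
  simpa using h.symm

/-- By adjunction `g` is a map `I ⊗ M → E`; its multiple by `t` kills the kernel of `I ⊗ M → M`, so
it extends to `M`. -/
theorem Flat.exists_smul_eq {t : R} {M E : Type u} [AddCommGroup M] [Module R M]
    [AddCommGroup E] [Module R E] (hM : Flat t M) (hE : Module.Injective R E) {I : Ideal R}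
    (hI : I.FG) (g : I →ₗ[R] M →ₗ[R] E) :
    ∃ m : M →ₗ[R] E, ∀ i : I, t • g i = (i : R) • m := by
  obtain ⟨k, hk⟩ := exists_comp_eq_of_ker_le hE
    (TensorProduct.lift ((LinearMap.lsmul R M).comp I.subtype)) (t • TensorProduct.lift g)
    (fun x hx ↦ by
      rw [LinearMap.mem_ker, LinearMap.smul_apply, ← map_smul, hM I hI x hx, map_zero])
  refine ⟨k, fun i ↦ LinearMap.ext fun y ↦ ?_⟩
  simpa using (hk (i ⊗ₜ y)).symm

theorem Inj.absPure {s : R} {M : Type u} [AddCommGroup M] [Module R M] (hM : Inj s M) :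
    AbsPure s M :=
  fun _ K _ f ↦ hM _ _ K.subtype K.injective_subtype f

theorem inj_of_injective (s : R) {M : Type u} [AddCommGroup M] [Module R M]
    (hM : Module.Injective R M) : Inj s M := by
  intro A B _ _ _ _ i hi f
  obtain ⟨g, hg⟩ := hM.out i hi (s • f)
  exact ⟨g, LinearMap.ext hg⟩

theorem flat_of_moduleFlat (s : R) {M : Type u} [AddCommGroup M] [Module R M]
    [Module.Flat R M] : Flat s M := by
  intro I _ x hx
  rw [(injective_iff_map_eq_zero _).mp
    ((Module.Flat.iff_lift_lsmul_comp_subtype_injective (R := R) (M := M)).mp ‹_› ‹_›) x hx,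
    smul_zero]

theorem Flat.of_linearEquiv {s : R} {M N : Type u} [AddCommGroup M] [Module R M] [AddCommGroup N]
    [Module R N] (hM : Flat s M) (e : M ≃ₗ[R] N) : Flat s N := by
  intro I hI x hx
  have h (y : I ⊗[R] N) : TensorProduct.lift ((LinearMap.lsmul R M).comp I.subtype)
      (e.symm.toLinearMap.lTensor I y) =
        e.symm (TensorProduct.lift ((LinearMap.lsmul R N).comp I.subtype) y) := by
    induction y with
    | zero => simp
    | tmul n h => simp
    | add x y hx hy => simp [hx, hy]
  refine (e.symm.lTensor I).injective ?_
  have := hM I hI (e.symm.toLinearMap.lTensor I x) (by rw [h, hx, map_zero])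
  rw [map_zero, map_smul]
  exact this

variable (R) in
theorem exists_isInjCogenerator :
    ∃ (E : Type u) (_ : AddCommGroup E) (_ : Module R E), IsInjCogenerator R E := by
  -- By adjunction, maps from `M` to the character module of `R` are the characters of `M`, which
  -- separate its elements.
  refine ⟨CharacterModule R, inferInstance, inferInstance,
    Module.Flat.iff_characterModule_injective.mp inferInstance, fun M _ _ x hx ↦ ?_⟩
  obtain ⟨c, hc⟩ := CharacterModule.exists_character_apply_ne_zero_of_ne_zero hx
  refine ⟨CharacterModule.curry (c.comp (TensorProduct.rid R M).toLinearMap.toAddMonoidHom),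
    fun h ↦ hc ?_⟩
  have h1 : c (TensorProduct.rid R M (x ⊗ₜ 1)) = 0 := DFunLike.congr_fun h (1 : R)
  simpa using h1

theorem IsInjCogenerator.pi {E : Type u} [AddCommGroup E] [Module R E] (hE : IsInjCogenerator R E)
    (J : Type u) [Nonempty J] : IsInjCogenerator R (J → E) := by
  have := hE.1
  refine ⟨inferInstance, fun M _ _ x hx ↦ ?_⟩
  obtain ⟨f, hf⟩ := hE.2 M x hx
  exact ⟨LinearMap.pi fun _ ↦ f, fun h ↦ hf (congr_fun h (Classical.arbitrary J))⟩

/-! ### From flatness back to coherence -/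

/-- Linear relations with coefficients in an `s`-flat module are, up to `s`, combinations of
relations in `R`. -/
theorem Flat.exists_of_sum_smul_eq_zero {s : R} {H : Type u} [AddCommGroup H] [Module R H]
    (hH : Flat s H) {n : ℕ} (a : Fin n → R) (h : Fin n → H) (hah : ∑ i, a i • h i = 0) :
    ∃ (m : ℕ) (b : Fin n → Fin m → R) (y : Fin m → H),
      (∀ i, s • h i = ∑ j, b i j • y j) ∧ ∀ j, ∑ i, b i j * a i = 0 := by
  let I : Ideal R := Ideal.span (Set.range a)
  let a' : Fin n → I := fun i ↦ ⟨a i, Ideal.subset_span ⟨i, rfl⟩⟩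
  have ha' : Submodule.span R (Set.range a') = ⊤ := by
    apply Submodule.map_injective_of_injective I.injective_subtype
    rw [Submodule.map_span, Submodule.map_subtype_top, ← Set.range_comp]
    rfl
  have h0 := hH I (Submodule.fg_span (Set.finite_range a)) (∑ i, a' i ⊗ₜ h i)
    (by simpa [a'] using hah)
  have h1 : ∑ i, a' i ⊗ₜ[R] (s • h i) = 0 := by
    simpa [Finset.smul_sum] using h0
  obtain ⟨m, b, y, hy, hb⟩ := TensorProduct.vanishesTrivially_of_sum_tmul_eq_zero R ha' h1
  exact ⟨m, b, y, hy, fun j ↦ by simpa [a'] using congr_arg Subtype.val (hb j)⟩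

/-- A family of relations of `a`, acting on finitely supported families in an injective module,
extends to all families as a relation of `a`. -/
theorem exists_extend_relations {E J : Type u} [DecidableEq J] [AddCommGroup E] [Module R E]
    (hE : Module.Injective R E) {n : ℕ} (a : Fin n → R) (k : J → Fin n → R)
    (hk : ∀ c, ∑ i, a i * k c i = 0) :
    ∃ h : Fin n → (J → E) →ₗ[R] E, ∑ i, a i • h i = 0 ∧
      ∀ c i, ∀ e : E, h i (Pi.single c e) = k c i • e := by
  -- Maps out of the quotient by `D` are the families `h` with `∑ i, a i • h i = 0`.
  let D : Submodule R (Fin n → J → E) :=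
    LinearMap.range (LinearMap.pi fun i ↦ a i • (LinearMap.id : (J → E) →ₗ[R] J → E))
  let ψ : (Fin n → J →₀ E) →ₗ[R] (Fin n → J → E) ⧸ D := D.mkQ ∘ₗ
    LinearMap.pi fun i ↦ Finsupp.lcoeFun ∘ₗ LinearMap.proj i
  let θ : (Fin n → J →₀ E) →ₗ[R] E :=
    ∑ i, Finsupp.lsum ℕ (fun c ↦ LinearMap.lsmul R E (k c i)) ∘ₗ LinearMap.proj i
  obtain ⟨g, hg⟩ := exists_comp_eq_of_ker_le hE ψ θ (by
    intro v hv
    have hv' : (fun i ↦ (v i : J → E)) ∈ D := by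
      rw [← D.ker_mkQ]
      exact hv
    obtain ⟨e, he⟩ := hv'
    have he' (i c) : v i c = a i • e c := by
      simpa using (congr_fun (congr_fun he i) c).symm
    classical
    -- The family `e` may have infinite support, so the sum runs over the supports of `v`.
    let T : Finset J := Finset.univ.biUnion fun i ↦ (v i).support
    have hT (i) : (v i).support ⊆ T := Finset.subset_biUnion_of_mem (fun i ↦ (v i).support) (Finset.mem_univ i)
    have h1 : θ v = ∑ i, ∑ c ∈ T, k c i • v i c := by
      simp only [θ, LinearMap.sum_apply, LinearMap.comp_apply, LinearMap.proj_apply,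
        Finsupp.lsum_apply]
      exact Finset.sum_congr rfl fun i _ ↦ Finsupp.sum_of_support_subset _ (hT i) _ (by simp)
    rw [LinearMap.mem_ker, h1, Finset.sum_comm]
    refine Finset.sum_eq_zero fun c _ ↦ ?_
    simp only [he', smul_smul, ← Finset.sum_smul]
    simp [mul_comm (k c _), hk])
  refine ⟨fun i ↦ g ∘ₗ D.mkQ ∘ₗ LinearMap.single R (fun _ ↦ J → E) i, ?_, fun c i e ↦ ?_⟩
  · ext f
    have : ∑ i, a i • Pi.single i f ∈ D := ⟨f, by
      ext i c
      simp [Pi.single_apply, apply_ite, ite_apply]⟩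
    have := congr_arg g (LinearMap.mem_ker.mp (D.ker_mkQ.symm ▸ this))
    simp only [map_sum, map_smul, map_zero] at this
    rw [LinearMap.sum_apply]
    exact this
  · have := hg (Pi.single i (Finsupp.single c e))
    have h1 : θ (Pi.single i (Finsupp.single c e)) = k c i • e := by
      simp only [θ, LinearMap.sum_apply, LinearMap.comp_apply, LinearMap.proj_apply]
      rw [Finset.sum_eq_single i] <;> simp +contextual
    rw [← h1, ← this]
    simp only [ψ, LinearMap.comp_apply]
    congr 2
    ext i' c'
    by_cases hi : i' = i
    · subst hi
      simp [Finsupp.single_eq_pi_single, Finsupp.lcoeFun]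
    · simp [hi, Finsupp.lcoeFun]

theorem finPres_of_flat {s : R} {E : Type u} [AddCommGroup E] [Module R E]
    (hE : IsInjCogenerator R E)
    (hflat : ∀ (J : Type u) [Nonempty J], Flat s ((J → E) →ₗ[R] E)) {I : Ideal R} (hI : I.FG) :
    FinPres s I := by
  classical
  obtain ⟨n, a, rfl⟩ := Submodule.fg_iff_exists_fin_generating_family.mp hI
  let p : (Fin n → R) →ₗ[R] R := Fintype.linearCombination R a
  have hp : LinearMap.range p = Submodule.span R (Set.range a) :=
    Fintype.range_linearCombination R a
  let K := LinearMap.ker p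
  obtain ⟨h, hah, hh⟩ := exists_extend_relations hE.1 a (fun c : K ↦ (c : Fin n → R))
    (fun c ↦ by
      have h : p c = 0 := c.2
      rw [Fintype.linearCombination_apply] at h
      simpa only [smul_eq_mul, mul_comm] using h)
  obtain ⟨m, b, y, hy, hb⟩ := (hflat K).exists_of_sum_smul_eq_zero a h hah
  let L : Submodule R (Fin n → R) := Submodule.span R (Set.range fun j i ↦ b i j)
  have hLK : L ≤ K := by
    rw [Submodule.span_le]
    rintro _ ⟨j, rfl⟩
    simpa [K, p, Fintype.linearCombination_apply] using hb j
  have hKL (c : K) : s • (c : Fin n → R) ∈ L := by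
    -- Otherwise some `f` into `E` kills `L` but not `s • c`. Yet `h i` at `e i` in place `c` is `c
    -- i • e i`, so the decomposition `hy` writes `f (s • c)` through the sums `∑ i, b i j • e i`,
    -- which vanish since `f` kills `L`.
    by_contra hc
    rw [← Submodule.Quotient.mk_eq_zero] at hc
    obtain ⟨f, hf⟩ := hE.2 _ _ hc
    let e : Fin n → E := fun i ↦ f (L.mkQ (Pi.single i 1))
    have hfe (r : Fin n → R) : f (L.mkQ r) = ∑ i, r i • e i := by
      have : r = ∑ i, r i • Pi.single i (1 : R) := by
        ext j
        simp [Pi.single_apply]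
      conv_lhs => rw [this]
      simp [e]
    refine hf ((hfe _).trans ?_)
    have h1 (i) : (s • (c : Fin n → R)) i • e i =
        ∑ j, b i j • y j (Pi.single c (e i)) := by
      have := LinearMap.congr_fun (hy i) (Pi.single c (e i))
      rw [LinearMap.smul_apply, hh, smul_smul, LinearMap.sum_apply] at this
      exact this
    simp only [h1]
    rw [Finset.sum_comm]
    refine Finset.sum_eq_zero fun j _ ↦ ?_
    have h2 : ∑ i, b i j • e i = 0 := by
      rw [← hfe (fun i ↦ b i j)]
      have : L.mkQ (fun i ↦ b i j) = 0 := by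
        rw [← LinearMap.mem_ker, Submodule.ker_mkQ]
        exact Submodule.subset_span ⟨j, rfl⟩
      rw [this, map_zero]
    have h3 : ∑ i, b i j • (Pi.single c (e i) : K → E) = 0 := by
      ext c'
      by_cases hc' : c' = c
      · subst hc'; simpa using h2
      · simp [hc']
    simpa using congr_arg (y j) h3
  let q : (Fin n → R) →ₗ[R] Submodule.span R (Set.range a) :=
    p.codRestrict _ fun r ↦ hp ▸ ⟨r, rfl⟩
  have hqK : LinearMap.ker q = K := LinearMap.ker_codRestrict _ _ _
  have hqs : Function.Surjective q := by
    rintro ⟨x, hx⟩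
    rw [← hp] at hx
    obtain ⟨r, rfl⟩ := hx
    exact ⟨r, rfl⟩
  refine ⟨(Fin n → R) ⧸ L, inferInstance, inferInstance, L.liftQ q (hqK ▸ hLK),
    Module.finitePresentation_of_surjective L.mkQ L.mkQ_surjective
      (by rw [Submodule.ker_mkQ]; exact Submodule.fg_span (Set.finite_range _)),
    fun x hx ↦ ?_, fun z ↦ ?_⟩
  · obtain ⟨r, rfl⟩ := L.mkQ_surjective x
    rw [← map_smul, ← LinearMap.mem_ker, Submodule.ker_mkQ]
    refine hKL ⟨r, ?_⟩
    rw [← hqK]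
    simpa using hx
  · obtain ⟨z, rfl⟩ := Submodule.Quotient.mk_surjective _ z
    obtain ⟨r, rfl⟩ := hqs z
    rw [← Submodule.Quotient.mk_smul, Submodule.Quotient.mk_eq_zero]
    exact ⟨L.mkQ (s • r), by simp⟩

end Lemmas

end UniformlyS

theorem theorem4p7 {R : Type u} [CommRing R] (S : Submonoid R) (hS : S ≤ nonZeroDivisors R) :
    List.TFAE [
      -- (1)
      UniformlyS.IsCoherentRing S,
      -- (2)
      ∃ s₁ ∈ S, ∃ s₂ ∈ S, ∀ (M E : Type u) [AddCommGroup M] [Module R M]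
        [AddCommGroup E] [Module R E],
        UniformlyS.AbsPure s₂ M → Module.Injective R E →
          UniformlyS.Flat s₁ (M →ₗ[R] E),
      -- (3)
      ∃ s₁ ∈ S, ∃ s₂ ∈ S, ∀ (M E : Type u) [AddCommGroup M] [Module R M]
        [AddCommGroup E] [Module R E],
        UniformlyS.Inj s₂ M → Module.Injective R E →
          UniformlyS.Flat s₁ (M →ₗ[R] E),
      -- (4)
      ∃ s₁ ∈ S, ∃ s₂ ∈ S, ∀ (M E : Type u) [AddCommGroup M] [Module R M]
        [AddCommGroup E] [Module R E],
        UniformlyS.Inj s₂ M → UniformlyS.IsInjCogenerator R E →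
          UniformlyS.Flat s₁ (M →ₗ[R] E),
      -- (5)
      ∃ s₁ ∈ S, ∃ s₂ ∈ S, ∀ (M E₁ E₂ : Type u) [AddCommGroup M] [Module R M]
        [AddCommGroup E₁] [Module R E₁] [AddCommGroup E₂] [Module R E₂],
        UniformlyS.Flat s₂ M → Module.Injective R E₁ → Module.Injective R E₂ →
          UniformlyS.Flat s₁ ((M →ₗ[R] E₁) →ₗ[R] E₂),
      -- (6)
      ∃ s₁ ∈ S, ∃ s₂ ∈ S, ∀ (M E₁ E₂ : Type u) [AddCommGroup M] [Module R M]
        [AddCommGroup E₁] [Module R E₁] [AddCommGroup E₂] [Module R E₂],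
        UniformlyS.Flat s₂ M → UniformlyS.IsInjCogenerator R E₁ →
          UniformlyS.IsInjCogenerator R E₂ →
          UniformlyS.Flat s₁ ((M →ₗ[R] E₁) →ₗ[R] E₂),
      -- (7)
      ∃ s ∈ S, ∀ (E₁ E₂ : Type u) [AddCommGroup E₁] [Module R E₁]
        [AddCommGroup E₂] [Module R E₂],
        UniformlyS.IsInjCogenerator R E₁ → UniformlyS.IsInjCogenerator R E₂ →
          UniformlyS.Flat s (E₁ →ₗ[R] E₂)] := by
  tfae_have 1 → 2 := by
    rintro ⟨s, hs, -, h⟩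
    exact ⟨s ^ 3 * s, mul_mem (pow_mem hs 3) hs, s, hs, fun M E _ _ _ _ hM hE I hI x hx ↦
      UniformlyS.smul_eq_zero_of_lift_eq_zero (h I hI) hE (hM.exists_smul_eq hI) hx⟩
  tfae_have 1 → 5 := by
    rintro ⟨s, hs, -, h⟩
    exact ⟨s ^ 3 * s, mul_mem (pow_mem hs 3) hs, s, hs,
      fun M E₁ E₂ _ _ _ _ _ _ hM hE₁ hE₂ I hI x hx ↦
        UniformlyS.smul_eq_zero_of_lift_eq_zero (h I hI) hE₂ (hM.exists_smul_eq hE₁ hI) hx⟩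
  tfae_have 2 → 3 := fun ⟨s₁, hs₁, s₂, hs₂, h⟩ ↦
    ⟨s₁, hs₁, s₂, hs₂, fun M E _ _ _ _ hM ↦ h M E hM.absPure⟩
  tfae_have 3 → 4 := fun ⟨s₁, hs₁, s₂, hs₂, h⟩ ↦
    ⟨s₁, hs₁, s₂, hs₂, fun M E _ _ _ _ hM hE ↦ h M E hM hE.1⟩
  tfae_have 4 → 7 := fun ⟨s₁, hs₁, s₂, _, h⟩ ↦
    ⟨s₁, hs₁, fun E₁ E₂ _ _ _ _ hE₁ ↦ h E₁ E₂ (UniformlyS.inj_of_injective s₂ hE₁.1)⟩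
  tfae_have 5 → 6 := fun ⟨s₁, hs₁, s₂, hs₂, h⟩ ↦
    ⟨s₁, hs₁, s₂, hs₂, fun M E₁ E₂ _ _ _ _ _ _ hM hE₁ hE₂ ↦ h M E₁ E₂ hM hE₁.1 hE₂.1⟩
  tfae_have 6 → 7 := fun ⟨s₁, hs₁, s₂, _, h⟩ ↦
    ⟨s₁, hs₁, fun E₁ E₂ _ _ _ _ hE₁ hE₂ ↦
      -- Take `M = R`, for which `Hom (R, E₁)` is `E₁`.
      (h R E₁ E₂ (UniformlyS.flat_of_moduleFlat s₂) hE₁ hE₂).of_linearEquiv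
        ((LinearMap.ringLmapEquivSelf R R E₁).congrLeft E₂ R)⟩
  tfae_have 7 → 1 := by
    rintro ⟨s, hs, h⟩
    obtain ⟨E, _, _, hE⟩ := UniformlyS.exists_isInjCogenerator R
    exact ⟨s, hs, ⟨⊤, Module.Finite.fg_top, fun _ ↦ trivial⟩, fun I hI ↦
      UniformlyS.finPres_of_flat hE (fun J _ ↦ h _ _ (hE.pi J) hE) hI⟩
  tfae_finish
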